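/- Let $q\ge 3$ be a prime power, and let $m\ge 2$, $0\le a\le m-1$, $1\le b\le q-1$ be integers. For a function $f:\mathbb F_q^m\to\mathbb F_q$, let $\deg f$ be the total degree of its reduced form, i.e. of the unique polynomial in $\mathbb F_q[X_1,\dots,X_m]$ of degree at most $q-1$ in each variable that induces $f$, and let $|f|=\#\{x: f(x)\ne 0\}$. Let $R_q(r,m)=\{f:\mathbb F_q^m\to\mathbb F_q : \deg f\le r\}$ be the generalized Reed–Muller code of order $r$, and let $W_3$, the third weight of $R_q(a(q-1)+b,m)$, be the third smallest element of the set of distinct weights $|f|$ of the nonzero codewords $f$. In each of the following cases the third weight exists and satisfies the stated bound. 1. If $b=1$: - for $q=3$, $m\ge 3$, $1\le a\le m-2$: $W_3\le 3^{m-a}$; - for $q=4$, $m\ge 3$, $1\le a\le m-2$: $W_3\le 18\cdot 4^{m-a-2}$; - for $q\in\{3,4\}$ and $a=m-1$: $W_3\le 2(q-1)$; - for $q\ge 5$ and $1\le a\le m-1$: $W_3\le 2(q-2)q^{m-a-1}$. 2. If $2\le b\le q-1$: - for $q\ge 5$, $0\le a\le m-2$ and $4\le b\le\lfloor \frac q2+2\rfloor$: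 $W_3\le (q-2)(q-b+2)q^{m-a-2}$; - if ($q\ge 7$, $0\le a\le m-2$ and $\lceil\frac q2+2\rceil\le b\le q-1$), or ($q\ge 4$, $0\le a\le m-2$ and $b=2$), or ($q\ge 4$, $a=m-2$ and $b=3$), or ($q=3$, $a\in\{0,m-2\}$ and $b=2$): $W_3\le (q-b+1)q^{m-a-1}$; - for $q\ge 4$, $m\ge 3$, $0\le a\le m-3$ and $b=3$: $W_3\le (q-1)^3q^{m-a-3}$; - for $q=3$, $m\ge 4$, $1\le a\le m-3$ and $b=2$: $W_3\le 16\cdot 3^{m-a-3}$. -/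

import Mathlib

/-- The reduced form exists and is unique: every function `f : 𝔽_q^m → 𝔽_q` is given by exactly one
polynomial whose degree in each variable is at most `q - 1`. -/
theorem existsUnique_reducedForm {F : Type*} [Field F] [Fintype F] {m : ℕ}
    (f : (Fin m → F) → F) :
    ∃! P : MvPolynomial (Fin m) F,
      P ∈ MvPolynomial.restrictDegree (Fin m) F (Fintype.card F - 1) ∧
        ∀ x : Fin m → F, MvPolynomial.eval x P = f x := by
  have hex : f ∈ (MvPolynomial.restrictDegree (Fin m) F (Fintype.card F - 1)).map
      (MvPolynomial.evalₗ F (Fin m)) := by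
    rw [MvPolynomial.map_restrict_dom_evalₗ]
    exact Submodule.mem_top
  obtain ⟨P, hP, hPf⟩ := hex
  refine ⟨P, ⟨hP, fun x => congrFun hPf x⟩, ?_⟩
  rintro Q ⟨hQ, hQf⟩
  rw [← sub_eq_zero]
  have hsub := Submodule.sub_mem _ hQ hP
  refine MvPolynomial.eq_zero_of_eval_zero_at_prod_finset (Q - P) (fun _ => Finset.univ) ?_ ?_
  · intro i
    have h1 : (Q - P).degreeOf i ≤ Fintype.card F - 1 := by
      rw [MvPolynomial.degreeOf_le_iff]
      intro s hs
      exact (MvPolynomial.mem_restrictDegree _ _ _).1 hsub s hs i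
    have h2 : 0 < Fintype.card F := Fintype.card_pos
    rw [Finset.card_univ]
    omega
  · intro x _
    have hx : MvPolynomial.eval x P = f x := congrFun hPf x
    simp [hQf x, hx]

/-- The reduced form of a function `f : 𝔽_q^m → 𝔽_q`. -/
noncomputable def reducedForm {F : Type*} [Field F] [Fintype F] {m : ℕ}
    (f : (Fin m → F) → F) : MvPolynomial (Fin m) F :=
  (existsUnique_reducedForm f).choose

theorem reducedForm_mem {F : Type*} [Field F] [Fintype F] {m : ℕ} (f : (Fin m → F) → F) :
    reducedForm f ∈ MvPolynomial.restrictDegree (Fin m) F (Fintype.card F - 1) :=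
  (existsUnique_reducedForm f).choose_spec.1.1

theorem eval_reducedForm {F : Type*} [Field F] [Fintype F] {m : ℕ} (f : (Fin m → F) → F)
    (x : Fin m → F) : MvPolynomial.eval x (reducedForm f) = f x :=
  (existsUnique_reducedForm f).choose_spec.1.2 x

theorem eq_reducedForm {F : Type*} [Field F] [Fintype F] {m : ℕ} (f : (Fin m → F) → F)
    (P : MvPolynomial (Fin m) F)
    (hP : P ∈ MvPolynomial.restrictDegree (Fin m) F (Fintype.card F - 1))
    (hPf : ∀ x : Fin m → F, MvPolynomial.eval x P = f x) : P = reducedForm f :=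
  (existsUnique_reducedForm f).choose_spec.2 P ⟨hP, hPf⟩

/-- The degree of a function `f : 𝔽_q^m → 𝔽_q`: the total degree of its reduced form. -/
noncomputable def functionDegree {F : Type*} [Field F] [Fintype F] {m : ℕ}
    (f : (Fin m → F) → F) : ℕ :=
  (reducedForm f).totalDegree

/-- The generalized Reed-Muller code `R_q(r, m)` of order `r` and length `q ^ m` over the finite
field `F` with `q` elements: the functions `F^m → F` of degree at most `r`. -/
noncomputable def generalizedReedMuller (F : Type*) [Field F] [Fintype F] (r m : ℕ) :
    Submodule F ((Fin m → F) → F) where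
  carrier := {f | functionDegree f ≤ r}
  zero_mem' := by
    have h : (0 : MvPolynomial (Fin m) F) = reducedForm (0 : (Fin m → F) → F) :=
      eq_reducedForm _ _ (Submodule.zero_mem _) (by intro x; simp)
    simp [functionDegree, ← h]
  add_mem' := by
    intro f g hf hg
    have h : reducedForm f + reducedForm g = reducedForm (f + g) :=
      eq_reducedForm _ _ (Submodule.add_mem _ (reducedForm_mem f) (reducedForm_mem g))
        (by intro x; simp [eval_reducedForm])
    simp only [Set.mem_ofPred_eq, functionDegree] at hf hg ⊢
    rw [← h]
    exact (MvPolynomial.totalDegree_add _ _).trans (max_le hf hg)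
  smul_mem' := by
    intro c f hf
    have h : c • reducedForm f = reducedForm (c • f) :=
      eq_reducedForm _ _ (Submodule.smul_mem _ c (reducedForm_mem f))
        (by intro x; simp [eval_reducedForm, MvPolynomial.smul_eval])
    simp only [Set.mem_ofPred_eq, functionDegree] at hf ⊢
    rw [← h]
    exact (MvPolynomial.totalDegree_smul_le c _).trans hf

/-- The Hamming weight `|f|` of `f : F^m → F`: the cardinality of its support. -/
noncomputable def functionWeight {F : Type*} [Zero F] {m : ℕ} (f : (Fin m → F) → F) : ℕ :=
  (Function.support f).ncard

/-- The set of weights of the nonzero codewords of a code `C`. -/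
def codeWeights {F : Type*} [Field F] {m : ℕ} (C : Submodule F ((Fin m → F) → F)) : Set ℕ :=
  {w | ∃ f ∈ C, f ≠ 0 ∧ functionWeight f = w}

/-- `w` is the `k`-th weight of `C` (`k ≥ 1`): the `k`-th smallest among the distinct weights of
the nonzero codewords, so that `k = 1` is the minimum weight. -/
def IsKthWeight {F : Type*} [Field F] {m : ℕ} (C : Submodule F ((Fin m → F) → F))
    (k w : ℕ) : Prop :=
  w ∈ codeWeights C ∧ {v | v ∈ codeWeights C ∧ v < w}.ncard + 1 = k

/-- The `k`-th weight is unique if it exists. -/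
theorem IsKthWeight.unique {F : Type*} [Field F] {m : ℕ} {C : Submodule F ((Fin m → F) → F)}
    {k w w' : ℕ} (h : IsKthWeight C k w) (h' : IsKthWeight C k w') : w = w' := by
  have key : ∀ u v : ℕ, IsKthWeight C k u → IsKthWeight C k v → ¬ u < v := by
    intro u v hu hv huv
    have hlt : {x | x ∈ codeWeights C ∧ x < u}.ncard < {x | x ∈ codeWeights C ∧ x < v}.ncard := by
      refine Set.ncard_lt_ncard ?_ ((Set.finite_lt_nat v).subset fun x hx => hx.2)
      refine ⟨fun x hx => ⟨hx.1, hx.2.trans huv⟩, fun hsub => ?_⟩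
      have hmem : u ∈ {x | x ∈ codeWeights C ∧ x < u} := hsub ⟨hu.1, huv⟩
      exact lt_irrefl u hmem.2
    have h1 := hu.2
    have h2 := hv.2
    omega
  exact le_antisymm (not_lt.1 (key w' w h' h)) (not_lt.1 (key w w' h h'))

/-! A bound on the third weight from above needs no classification of codewords: three distinct
weights, the largest at most the bound, suffice. All of them come from products of linear factors `x
i - c`. With `d i ≤ q - 1` distinct factors in coordinate `i`, the support is a box with sides `q -
d i`, so the weight is `∏ (q - d i)` and the degree is at most `∑ d i` (`prod_sub_mem_codeWeights`).
Each case is then a choice of three ways to spend the degree `a(q-1) + b`: pin `a` or `a - 1`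
coordinates to a point at cost `q - 1` each, and split what remains over a few others.
`exists_isKthWeight_three` turns the three weights into the bound. -/

open MvPolynomial in
theorem mem_generalizedReedMuller_of_eval {F : Type*} [Field F] [Fintype F] {r m : ℕ}
    {f : (Fin m → F) → F} (P : MvPolynomial (Fin m) F)
    (hP : ∀ i, P.degreeOf i ≤ Fintype.card F - 1) (hr : P.totalDegree ≤ r)
    (hPf : ∀ x, eval x P = f x) : f ∈ generalizedReedMuller F r m := by
  have h : P = reducedForm f := eq_reducedForm f P
    ((mem_restrictDegree _ _ _).2 fun s hs i => degreeOf_le_iff.1 (hP i) s hs) hPf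
  change (reducedForm f).totalDegree ≤ r
  rwa [← h]

open MvPolynomial in
/-- A product of `d i` linear factors in the variable `X i`, for all `i`, has weight
`∏ i, (q - d i)`. -/
theorem prod_sub_mem_codeWeights {F : Type*} [Field F] [Fintype F] {r m : ℕ} (d : Fin m → ℕ)
    (hd : ∀ i, d i ≤ Fintype.card F - 1) (hr : ∑ i, d i ≤ r) :
    ∏ i, (Fintype.card F - d i) ∈ codeWeights (generalizedReedMuller F r m) := by
  classical
  have hcard : 0 < Fintype.card F := Fintype.card_pos
  have hS : ∀ i, ∃ S : Finset F, S.card = d i := fun i => by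
    obtain ⟨S, -, hS⟩ := Finset.exists_subset_card_eq (s := (Finset.univ : Finset F)) (n := d i)
      (by rw [Finset.card_univ]; exact (hd i).trans (Nat.sub_le _ _))
    exact ⟨S, hS⟩
  choose S hS using hS
  let f : (Fin m → F) → F := fun x => ∏ i, ∏ c ∈ S i, (x i - c)
  have hsupp : Function.support f = ↑(Fintype.piFinset fun i => (S i)ᶜ) := by
    ext x
    simp only [f, Function.mem_support, Finset.prod_ne_zero_iff, Finset.mem_coe,
      Fintype.mem_piFinset, Finset.mem_compl, sub_ne_zero, Finset.mem_univ, forall_true_left]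
    exact forall_congr' fun i => ⟨fun h hi => h _ hi rfl, fun h c hc hx => h (hx ▸ hc)⟩
  have hw : functionWeight f = ∏ i, (Fintype.card F - d i) := by
    rw [functionWeight, hsupp, Set.ncard_coe_finset, Fintype.card_piFinset]
    exact Finset.prod_congr rfl fun i _ => by rw [Finset.card_compl, hS]
  refine ⟨f, ?_, ?_, hw⟩
  · refine mem_generalizedReedMuller_of_eval (∏ i, ∏ c ∈ S i, (X i - C c)) ?_ ?_ ?_
    · intro j
      refine le_trans ((degreeOf_prod_le _ _ _).trans ?_) (hd j)
      -- Only the factors with `i = j` involve `X j`.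
      calc ∑ i, degreeOf j (∏ c ∈ S i, (X i - C c : MvPolynomial (Fin m) F))
          ≤ ∑ i, if j = i then d j else 0 := Finset.sum_le_sum fun i _ => by
            refine (degreeOf_prod_le _ _ _).trans ?_
            refine (Finset.sum_le_card_nsmul _ _ (if j = i then 1 else 0) fun c _ => ?_).trans ?_
            · refine (degreeOf_sub_le _ _ _).trans ?_
              simp [degreeOf_X, degreeOf_C]
            · rw [hS]
              split_ifs with h <;> simp [h]
        _ = d j := by simp
    · refine (totalDegree_finsetProd _ _).trans (le_trans (Finset.sum_le_sum fun i _ => ?_) hr)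
      refine (totalDegree_finsetProd _ _).trans ?_
      refine (Finset.sum_le_card_nsmul _ _ 1 fun c _ => ?_).trans (by simp [hS])
      refine (totalDegree_sub _ _).trans ?_
      simp
    · intro x
      simp [f, map_prod]
  -- Each side `q - d i` is at least 1, so the box is nonempty.
  · intro h0
    have hpos : 0 < functionWeight f := by
      rw [hw]
      exact Finset.prod_pos fun i _ => by have := hd i; omega
    simp [h0, functionWeight] at hpos

/-- The weights `q ^ (m - a - l) * ∏ (q - e)`, where `e` runs over a list of length `l`. -/
theorem list_prod_sub_mem_codeWeights {F : Type*} [Field F] [Fintype F] {r m : ℕ} (a : ℕ)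
    (L : List ℕ) (hL : ∀ e ∈ L, e ≤ Fintype.card F - 1) (hm : a + L.length ≤ m)
    (hr : a * (Fintype.card F - 1) + L.sum ≤ r) :
    (L.map (Fintype.card F - ·)).prod * Fintype.card F ^ (m - a - L.length) ∈
      codeWeights (generalizedReedMuller F r m) := by
  have hcard : 0 < Fintype.card F := Fintype.card_pos
  obtain ⟨k, rfl⟩ := Nat.exists_eq_add_of_le hm
  -- `a` coordinates pinned to a point (side 1), then the sides `q - e`, then `k` free coordinates
  -- (side `q`).
  let D := List.replicate a (Fintype.card F - 1) ++ L ++ List.replicate k 0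
  have hlen : D.length = a + L.length + k := by simp [D, add_assoc]
  have hmem : ∀ e ∈ D, e ≤ Fintype.card F - 1 := by
    intro e he
    simp only [D, List.mem_append, List.mem_replicate] at he
    rcases he with (⟨-, rfl⟩ | he) | ⟨-, rfl⟩
    exacts [le_rfl, hL e he, Nat.zero_le _]
  have h := prod_sub_mem_codeWeights (r := r) (fun i : Fin D.length => D[i.1])
    (fun i => hmem _ (List.getElem_mem _)) (by rw [Fin.sum_univ_getElem]; simpa [D] using hr)
  have hprod : ∏ i : Fin D.length, (Fintype.card F - D[i.1]) =
      (L.map (Fintype.card F - ·)).prod * Fintype.card F ^ (a + L.length + k - a - L.length) := by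
    rw [Fin.prod_univ_fun_getElem D (Fintype.card F - ·)]
    have h1 : Fintype.card F - (Fintype.card F - 1) = 1 := by omega
    have h2 : a + L.length + k - a - L.length = k := by omega
    simp [D, h1, h2]
  rw [hprod, hlen] at h
  exact h

theorem exists_isKthWeight_three {F : Type*} [Field F] {m : ℕ}
    {C : Submodule F ((Fin m → F) → F)} {u v w B : ℕ} (hu : u ∈ codeWeights C)
    (hv : v ∈ codeWeights C) (hw : w ∈ codeWeights C) (huv : u < v) (hvw : v < w) (hB : w ≤ B) :
    ∃ W, IsKthWeight C 3 W ∧ W ≤ B := by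
  classical
  let p : ℕ → Prop := (· ∈ codeWeights C)
  have hcount : ∀ n, {x | x ∈ codeWeights C ∧ x < n}.ncard = Nat.count p n := by
    intro n
    rw [Nat.count_eq_card_filter_range, ← Set.ncard_coe_finset]
    congr 1
    ext x
    simp [p, and_comm]
  have h3 : 2 < Nat.count p (w + 1) := by
    have h1 := Nat.count_strict_mono (p := p) hu huv
    have h2 := Nat.count_strict_mono (p := p) hv hvw
    have h4 : Nat.count p (w + 1) = Nat.count p w + 1 := by
      rw [Nat.count_succ, if_pos hw]
    omega
  have hlt : Nat.nth p 2 < w + 1 := Nat.nth_lt_of_lt_count h3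
  -- `Nat.nth` counts from 0, so the third weight has index 2. This bound rules out its default
  -- value 0 on a finite set that is too small.
  have hfin : ∀ hf : {x | p x}.Finite, 2 < hf.toFinset.card := fun hf =>
    h3.trans_le (Nat.count_le_card hf _)
  refine ⟨Nat.nth p 2, ⟨Nat.nth_mem 2 hfin, ?_⟩, by omega⟩
  rw [hcount, Nat.count_nth hfin]

/-! ### Numerical choice of the three weights in each case. -/

set_option maxHeartbeats 2000000 in
theorem mainTheorem5 {F : Type*} [Field F] [Fintype F] (q m a b : ℕ)
    (hqF : Fintype.card F = q) (hq : 3 ≤ q) (hm : 2 ≤ m) (ha : a ≤ m - 1)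
    (hb : 1 ≤ b) (hbq : b ≤ q - 1) :
    (b = 1 →
      (q = 3 ∧ 3 ≤ m ∧ 1 ≤ a ∧ a ≤ m - 2 →
        ∃ W₃, IsKthWeight (generalizedReedMuller F (a * (q - 1) + b) m) 3 W₃ ∧
          W₃ ≤ 3 ^ (m - a)) ∧
      (q = 4 ∧ 3 ≤ m ∧ 1 ≤ a ∧ a ≤ m - 2 →
        ∃ W₃, IsKthWeight (generalizedReedMuller F (a * (q - 1) + b) m) 3 W₃ ∧
          W₃ ≤ 18 * 4 ^ (m - a - 2)) ∧
      ((q = 3 ∧ a = m - 1) ∨ (q = 4 ∧ a = m - 1) →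
        ∃ W₃, IsKthWeight (generalizedReedMuller F (a * (q - 1) + b) m) 3 W₃ ∧
          W₃ ≤ 2 * (q - 1)) ∧
      (5 ≤ q ∧ 1 ≤ a →
        ∃ W₃, IsKthWeight (generalizedReedMuller F (a * (q - 1) + b) m) 3 W₃ ∧
          W₃ ≤ 2 * (q - 2) * q ^ (m - a - 1))) ∧
    (2 ≤ b →
      (5 ≤ q ∧ a ≤ m - 2 ∧ 4 ≤ b ∧ b ≤ ⌊(q : ℚ) / 2 + 2⌋₊ →
        ∃ W₃, IsKthWeight (generalizedReedMuller F (a * (q - 1) + b) m) 3 W₃ ∧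
          W₃ ≤ (q - 2) * (q - b + 2) * q ^ (m - a - 2)) ∧
      ((7 ≤ q ∧ a ≤ m - 2 ∧ ⌈(q : ℚ) / 2 + 2⌉₊ ≤ b) ∨
          (4 ≤ q ∧ a ≤ m - 2 ∧ b = 2) ∨
          (4 ≤ q ∧ a = m - 2 ∧ b = 3) ∨
          (q = 3 ∧ (a = 0 ∨ a = m - 2) ∧ b = 2) →
        ∃ W₃, IsKthWeight (generalizedReedMuller F (a * (q - 1) + b) m) 3 W₃ ∧
          W₃ ≤ (q - b + 1) * q ^ (m - a - 1)) ∧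
      (4 ≤ q ∧ 3 ≤ m ∧ a ≤ m - 3 ∧ b = 3 →
        ∃ W₃, IsKthWeight (generalizedReedMuller F (a * (q - 1) + b) m) 3 W₃ ∧
          W₃ ≤ (q - 1) ^ 3 * q ^ (m - a - 3)) ∧
      (q = 3 ∧ 4 ≤ m ∧ 1 ≤ a ∧ a ≤ m - 3 ∧ b = 2 →
        ∃ W₃, IsKthWeight (generalizedReedMuller F (a * (q - 1) + b) m) 3 W₃ ∧
          W₃ ≤ 16 * 3 ^ (m - a - 3)))
      := by
  -- Every weight used is that of a product of linear factors in the coordinates.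
  have key : ∀ (c : ℕ) (L : List ℕ), c ≤ a → (∀ e ∈ L, e ≤ q - 1) → c + L.length ≤ m →
      L.sum ≤ (a - c) * (q - 1) + b → (L.map (q - ·)).prod * q ^ (m - c - L.length) ∈
        codeWeights (generalizedReedMuller F (a * (q - 1) + b) m) := by
    intro c L hc hL hlen hsum
    subst hqF
    refine list_prod_sub_mem_codeWeights c L hL hlen ?_
    obtain ⟨d, rfl⟩ := Nat.exists_eq_add_of_le hc
    rw [Nat.add_sub_cancel_left] at hsum
    rw [add_mul]
    omega
  -- A common factor `q ^ k` is split off, so that only the small cofactors need comparing.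
  have pull : ∀ (c : ℕ) (L : List ℕ) (w k : ℕ), c ≤ a → (∀ e ∈ L, e ≤ q - 1) →
      c + L.length ≤ m → L.sum ≤ (a - c) * (q - 1) + b →
      (L.map (q - ·)).prod * q ^ (m - c - L.length - k) = w → k ≤ m - c - L.length →
      w * q ^ k ∈ codeWeights (generalizedReedMuller F (a * (q - 1) + b) m) := by
    intro c L w k hc hL hlen hsum hw hk
    have h := key c L hc hL hlen hsum
    rwa [← Nat.sub_add_cancel hk, pow_add, ← mul_assoc, hw] at h
  have fin : ∀ {u v w k B : ℕ},
      u * q ^ k ∈ codeWeights (generalizedReedMuller F (a * (q - 1) + b) m) →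
      v * q ^ k ∈ codeWeights (generalizedReedMuller F (a * (q - 1) + b) m) →
      w * q ^ k ∈ codeWeights (generalizedReedMuller F (a * (q - 1) + b) m) →
      u < v → v < w → w * q ^ k = B →
      ∃ W₃, IsKthWeight (generalizedReedMuller F (a * (q - 1) + b) m) 3 W₃ ∧ W₃ ≤ B := by
    intro u v w k B hu hv hw huv hvw hB
    have hpos : 0 < q ^ k := pow_pos (by omega) k
    exact exists_isKthWeight_three hu hv hw (Nat.mul_lt_mul_of_pos_right huv hpos)
      (Nat.mul_lt_mul_of_pos_right hvw hpos) hB.le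
  refine ⟨?_, ?_⟩
  · rintro rfl
    refine ⟨?_, ?_, ?_, ?_⟩
    · rintro ⟨rfl, hm3, ha1, ha2⟩
      obtain ⟨n, rfl⟩ : ∃ n, m = a + 2 + n := ⟨m - a - 2, by omega⟩
      have hs : a - (a - 1) = 1 := by omega
      refine fin (k := n) (pull a [1] 6 n le_rfl (by simp) (by simp; omega) (by simp) ?_ ?_)
        (pull (a - 1) [1, 1, 1] 8 n (by omega) (by simp) (by simp; omega) (by simp [hs]) ?_ ?_)
        (pull a [] 9 n le_rfl (by simp) (by simp; omega) (by simp) ?_ ?_)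
        (by norm_num) (by norm_num) ?_
      · rw [show a + 2 + n - a - [1].length - n = 1 by simp; omega]; rfl
      · simp; omega
      · rw [show a + 2 + n - (a - 1) - [1, 1, 1].length - n = 0 by simp; omega]; rfl
      · simp; omega
      · rw [show a + 2 + n - a - [].length - n = 2 by simp; omega]; rfl
      · simp; omega
      · rw [show a + 2 + n - a = 2 + n by omega, pow_add]; rfl
    · rintro ⟨rfl, hm3, ha1, ha2⟩
      obtain ⟨n, rfl⟩ : ∃ n, m = a + 2 + n := ⟨m - a - 2, by omega⟩
      have hs : a - (a - 1) = 1 := by omega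
      -- For `q = 4` the released budget is 3 + 1 = 4 = 2 + 1 + 1, giving 2 · 3 · 3 = 18, just above
      -- 12 and 16.
      refine fin (k := n) (pull a [1] 12 n le_rfl (by simp) (by simp; omega) (by simp) ?_ ?_)
        (pull a [] 16 n le_rfl (by simp) (by simp; omega) (by simp) ?_ ?_)
        (pull (a - 1) [2, 1, 1] 18 n (by omega) (by simp) (by simp; omega) (by simp [hs]) ?_ ?_)
        (by norm_num) (by norm_num) ?_
      · rw [show a + 2 + n - a - [1].length - n = 1 by simp; omega]; rfl
      · simp; omega
      · rw [show a + 2 + n - a - [].length - n = 2 by simp; omega]; rfl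
      · simp; omega
      · rw [show a + 2 + n - (a - 1) - [2, 1, 1].length - n = 0 by simp; omega]; rfl
      · simp; omega
      · rw [show a + 2 + n - a - 2 = n by omega]
    · intro h
      have ham : m = a + 1 := by omega
      subst ham
      have hs : a - (a - 1) = 1 := by omega
      refine fin (k := 0) (pull a [1] (q - 1) 0 le_rfl (by simp; omega) (by simp) (by simp) ?_ ?_)
        (pull a [] q 0 le_rfl (by simp) (by simp) (by simp) ?_ ?_)
        (pull (a - 1) [q - 2, 1] (2 * (q - 1)) 0 (by omega) (by simp; omega) (by simp; omega)
          (by simp [hs]; omega) ?_ ?_)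
        (by omega) (by omega) ?_
      · simp
      · simp
      · simp
      · simp
      · rw [show a + 1 - (a - 1) - [q - 2, 1].length - 0 = 0 by simp; omega]
        simp [show q - (q - 2) = 2 by omega]
      · simp
      · simp
    · rintro ⟨hq5, ha1⟩
      obtain ⟨n, rfl⟩ : ∃ n, m = a + 1 + n := ⟨m - a - 1, by omega⟩
      have hs : a - (a - 1) = 1 := by omega
      -- `q < 2(q - 2)` is exactly `q > 4`.
      refine fin (k := n) (pull a [1] (q - 1) n le_rfl (by simp; omega) (by simp)
          (by simp) ?_ ?_)
        (pull a [] q n le_rfl (by simp) (by simp; omega) (by simp) ?_ ?_)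
        (pull (a - 1) [q - 2, 2] (2 * (q - 2)) n (by omega) (by simp; omega) (by simp; omega)
          (by simp [hs]; omega) ?_ ?_)
        (by omega) (by omega) ?_
      · rw [show a + 1 + n - a - [1].length - n = 0 by simp; omega]; simp
      · simp; omega
      · rw [show a + 1 + n - a - [].length - n = 1 by simp; omega]; simp
      · simp; omega
      · rw [show a + 1 + n - (a - 1) - [q - 2, 2].length - n = 0 by simp; omega]
        simp [show q - (q - 2) = 2 by omega]
      · simp; omega
      · rw [show a + 1 + n - a - 1 = n by omega]
  · intro hb2
    -- This removes truncated subtraction: the weight comparisons become polynomial inequalities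
    -- whose nonlinear terms `linarith` can treat as atoms.
    obtain ⟨s, rfl⟩ : ∃ s, q = b + s + 1 := ⟨q - b - 1, by omega⟩
    have hsb : b + s + 1 - b = s + 1 := by omega
    have hs1 : b + s + 1 - (b - 1) = s + 2 := by omega
    have hs2 : b + s + 1 - 1 = b + s := by omega
    refine ⟨?_, ?_, ?_, ?_⟩
    · rintro ⟨-, ha2, hb4, -⟩
      obtain ⟨n, rfl⟩ : ∃ n, m = a + 2 + n := ⟨m - a - 2, by omega⟩
      obtain ⟨t, rfl⟩ : ∃ t, b = t + 4 := ⟨b - 4, by omega⟩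
      have he : a + 2 + n - a - 2 - n = 0 := by omega
      have hs3 : t + 4 + s + 1 - (t + 4 - 2) = s + 3 := by omega
      have hs4 : t + 4 + s + 1 - 2 = t + s + 3 := by omega
      -- Flatter splittings of `b` give larger boxes. The successive cofactors differ by `b - 1` and
      -- `b - 3`, whence `b ≥ 4`. The entry 0 is padding that equalizes list lengths.
      refine fin (k := n)
        (pull a [t + 4, 0] ((s + 1) * (t + 4 + s + 1)) n le_rfl (by simp) (by simp)
          (by simp) ?_ ?_)
        (pull a [t + 4 - 1, 1] ((s + 2) * (t + 4 + s)) n le_rfl (by simp; omega) (by simp)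
          (by simp) ?_ ?_)
        (pull a [t + 4 - 2, 2] ((s + 3) * (t + s + 3)) n le_rfl (by simp; omega) (by simp)
          (by simp) ?_ ?_)
        (by linarith) (by linarith) ?_
      · simp only [List.map_cons, List.map_nil, List.prod_cons, List.prod_nil, List.length_cons,
          List.length_nil, hsb, Nat.sub_zero, zero_add, Nat.reduceAdd, he]
        ring
      · simp; omega
      · simp only [List.map_cons, List.map_nil, List.prod_cons, List.prod_nil, List.length_cons,
          List.length_nil, hs1, hs2, zero_add, Nat.reduceAdd, he]
        ring
      · simp; omega
      · simp only [List.map_cons, List.map_nil, List.prod_cons, List.prod_nil, List.length_cons,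
          List.length_nil, hs3, hs4, zero_add, Nat.reduceAdd, he]
        ring
      · simp; omega
      · rw [hsb, hs4, show a + 2 + n - a - 2 = n by omega]
        ring
    · intro h
      obtain ⟨n, rfl⟩ : ∃ n, m = a + 2 + n := ⟨m - a - 2, by omega⟩
      have he : a + 2 + n - a - 2 - n = 0 := by omega
      -- The third word has degree below the maximum: one linear factor is dropped, so the side `q -
      -- 1` grows to `q`.
      refine fin (k := n)
        (pull a [b, 0] ((s + 1) * (b + s + 1)) n le_rfl (by simp) (by simp)
          (by simp) ?_ ?_)
        (pull a [b - 1, 1] ((s + 2) * (b + s)) n le_rfl (by simp; omega) (by simp)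
          (by simp; omega) ?_ ?_)
        (pull a [b - 1, 0] ((s + 2) * (b + s + 1)) n le_rfl (by simp; omega) (by simp)
          (by simp) ?_ ?_)
        (by linarith) (by linarith) ?_
      · simp only [List.map_cons, List.map_nil, List.prod_cons, List.prod_nil, List.length_cons,
          List.length_nil, hsb, Nat.sub_zero, zero_add, Nat.reduceAdd, he]
        ring
      · simp; omega
      · simp only [List.map_cons, List.map_nil, List.prod_cons, List.prod_nil, List.length_cons,
          List.length_nil, hs1, hs2, zero_add, Nat.reduceAdd, he]
        ring
      · simp; omega
      · simp only [List.map_cons, List.map_nil, List.prod_cons, List.prod_nil, List.length_cons,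
          List.length_nil, hs1, Nat.sub_zero, zero_add, Nat.reduceAdd, he]
        ring
      · simp; omega
      · rw [hsb, show a + 2 + n - a - 1 = n + 1 by omega]
        ring
    · rintro ⟨-, hm3, ha3, rfl⟩
      obtain ⟨n, rfl⟩ : ∃ n, m = a + 3 + n := ⟨m - a - 3, by omega⟩
      have he : a + 3 + n - a - 3 - n = 0 := by omega
      have hs3 : 3 + s + 1 - 2 = s + 2 := by omega
      -- For `b = 3` the split `[b - 2, 2]` repeats `[2, 1]`, so the third weight spreads over a
      -- third coordinate.
      refine fin (k := n)
        (pull a [3, 0, 0] ((s + 1) * (s + 4) ^ 2) n le_rfl (by simp) (by simp)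
          (by simp) ?_ ?_)
        (pull a [2, 1, 0] ((s + 2) * (s + 3) * (s + 4)) n le_rfl (by simp; omega) (by simp)
          (by simp) ?_ ?_)
        (pull a [1, 1, 1] ((s + 3) ^ 3) n le_rfl (by simp; omega) (by simp)
          (by simp) ?_ ?_)
        (by linarith) (by linarith) ?_
      · simp only [List.map_cons, List.map_nil, List.prod_cons, List.prod_nil, List.length_cons,
          List.length_nil, hsb, Nat.sub_zero, zero_add, Nat.reduceAdd, he]
        ring
      · simp; omega
      · simp only [List.map_cons, List.map_nil, List.prod_cons, List.prod_nil, List.length_cons,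
          List.length_nil, hs3, hs2, Nat.sub_zero, zero_add, Nat.reduceAdd, he]
        ring
      · simp; omega
      · simp only [List.map_cons, List.map_nil, List.prod_cons, List.prod_nil, List.length_cons,
          List.length_nil, hs2, zero_add, Nat.reduceAdd, he]
        ring
      · simp; omega
      · rw [hs2, show a + 3 + n - a - 3 = n by omega, add_comm s 3]
    · rintro ⟨hq3, hm4, ha1, ha3, rfl⟩
      obtain rfl : s = 0 := by omega
      obtain ⟨n, rfl⟩ : ∃ n, m = a + 3 + n := ⟨m - a - 3, by omega⟩
      have hs : a - (a - 1) = 1 := by omega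
      -- Unpinning one coordinate gives degree 2 + 2 = 4 for four factors, and 2 ^ 4 = 16.
      refine fin (k := n) (pull a [2] 9 n le_rfl (by simp) (by simp; omega) (by simp) ?_ ?_)
        (pull a [1, 1] 12 n le_rfl (by simp) (by simp; omega) (by simp) ?_ ?_)
        (pull (a - 1) [1, 1, 1, 1] 16 n (by omega) (by simp) (by simp; omega) (by simp [hs]) ?_ ?_)
        (by norm_num) (by norm_num) ?_
      · rw [show a + 3 + n - a - [2].length - n = 2 by simp; omega]; rfl
      · simp; omega
      · rw [show a + 3 + n - a - [1, 1].length - n = 1 by simp; omega]; rfl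
      · simp; omega
      · rw [show a + 3 + n - (a - 1) - [1, 1, 1, 1].length - n = 0 by simp; omega]; rfl
      · simp; omega
      · rw [show a + 3 + n - a - 3 = n by omega]
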